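/- Consider an oriented graph with a finite set of nodes and a finite set $\mathcal{A}$ of arcs, a finite set $\mathcal{N}$ of origin/destination (O/D) pairs of nodes and, for each $s\in\mathcal{N}$, a finite set $\mathcal{P}_s$ of directed paths from the origin to the destination of $s$ and a finite set $\mathcal{B}_s$ of pairs of users. (Flows and demands are indexed separately for different O/D pairs.) For path flows $x=(x_p)_{p\in\mathcal{P}_s,\,s\in\mathcal{N}}$ put $\alpha_{pa}=1$ if arc $a$ belongs to path $p$ and $\alpha_{pa}=0$ otherwise, and $$f_a=\sum_{s\in\mathcal{N}}\sum_{p\in\mathcal{P}_s}\alpha_{pa}x_p,\qquad g_p(x)=\sum_{a\in\mathcal{A}}\alpha_{pa}c_a(f),\qquad f=(f_a)_{a\in\mathcal{A}},$$ where $c_a$ is a real-valued function of the arc flow vector $f$ for each $a\in\mathcal{A}$. For each $j\in\mathcal{B}_s$, $s\in\mathcal{N}$, let $h_j$ be a real-valued function of the whole demand vector $y=(y_j)_{j\in\mathcal{B}_s,\,s\in\mathcal{N}}$, and let $\gamma_j$ be an upper bound for the demand $y_j$. Let $$W=\Bigl\{(x,y)\ :\ \sum_{p\in\mathcal{P}_s}x_p=\sum_{j\in\mathcal{B}_s}y_j,\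 \ x_p\ge 0\ \ \forall p\in\mathcal{P}_s,\ \ 0\le y_j\le\gamma_j\ \ \forall j\in\mathcal{B}_s,\ \ \forall s\in\mathcal{N}\Bigr\}.$$ **Theorem 4.1.** Suppose that $\gamma_j=+\infty$ for all $j\in\mathcal{B}_s$, $s\in\mathcal{N}$, that $W$ is nonempty, that all the functions $c_a$ and $h_j$ are continuous (on the nonnegative orthants of arc flow vectors and demand vectors, respectively), and that the following coercivity condition holds: (C1) there exists a number $r>0$ such that for every $(x,y)\in W$, every $s\in\mathcal{N}$ and every $j\in\mathcal{B}_s$ with $y_j>r$ there exists $p\in\mathcal{P}_s$ such that $x_p>0$ and $g_p(x)\ge h_j(y)$. Then there exists a pair $(x^*,y^*)\in W$ such that $$\sum_{s\in\mathcal{N}}\sum_{p\in\mathcal{P}_s}g_p(x^*)(x_p-x_p^*)-\sum_{s\in\mathcal{N}}\sum_{j\in\mathcal{B}_s}h_j(y^*)(y_j-y_j^*)\ge 0\qquad\forall (x,y)\in W.$$ -/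

import Mathlib

/-- `IsDirectedPath src dst i j p`: the list of arcs `p` is a directed path from node `i` to
node `j`, i.e. the arcs are consecutive, the first one starts at `i` and the last one ends at `j`.
Nodes are allowed to repeat, so this covers both the simple-path and the general convention. -/
def IsDirectedPath {V A : Type*} (src dst : A → V) : V → V → List A → Prop
  | i, j, [] => i = j
  | i, j, a :: p => src a = i ∧ IsDirectedPath src dst (dst a) j p

/-- The combinatorial data of the network problem: an oriented graph with nodes `V` and arcs `A`,
a finite set of origin-destination pairs, and, for each O/D pair, a finite set of directed paths
from its origin to its destination and a finite set of pairs of users. -/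
structure ElasticNetwork (V A U : Type*) where
  /-- origin of an arc -/
  src : A → V
  /-- destination of an arc -/
  dst : A → V
  /-- the O/D pairs (origin, destination) -/
  odPairs : Finset (V × V)
  /-- the set of paths of an O/D pair -/
  paths : odPairs → Finset (List A)
  /-- every path of an O/D pair joins its origin to its destination -/
  isPath : ∀ s : odPairs, ∀ p ∈ paths s, IsDirectedPath src dst s.1.1 s.1.2 p
  /-- the set of pairs of users of an O/D pair -/
  users : odPairs → Finset U

namespace ElasticNetwork

variable {V A U : Type*}

/-- Path flow vectors: one number for each path of each O/D pair. -/
abbrev PathFlow (N : ElasticNetwork V A U) : Type _ :=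
  (s : N.odPairs) → N.paths s → ℝ

/-- Demand vectors: one number for each pair of users of each O/D pair. -/
abbrev Demand (N : ElasticNetwork V A U) : Type _ :=
  (s : N.odPairs) → N.users s → ℝ

open Classical in
/-- The path-arc incidence number: `1` if the arc `a` belongs to the path `p`, `0` otherwise. -/
noncomputable def incidence (p : List A) (a : A) : ℝ := if a ∈ p then 1 else 0

/-- The arc flows generated by a path flow vector. -/
noncomputable def arcFlow (N : ElasticNetwork V A U) (x : N.PathFlow) : A → ℝ :=
  fun a => ∑ s, ∑ p, incidence p.1 a * x s p

/-- The dis-utility of a path: the sum of the dis-utilities of its arcs at the current arc flows. -/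
noncomputable def pathCost [Fintype A] (N : ElasticNetwork V A U) (c : A → (A → ℝ) → ℝ)
    (x : N.PathFlow) (s : N.odPairs) (p : N.paths s) : ℝ :=
  ∑ a, incidence p.1 a * c a (N.arcFlow x)

/-- The set of feasible flow / demand pairs, for upper demand bounds `γ` (`⊤` means no bound). -/
def feasibleSet (N : ElasticNetwork V A U) (γ : (s : N.odPairs) → N.users s → EReal) :
    Set (N.PathFlow × N.Demand) :=
  {w | ∀ s, (∑ p, w.1 s p = ∑ j, w.2 s j) ∧ (∀ p, 0 ≤ w.1 s p) ∧
    (∀ j, 0 ≤ w.2 s j ∧ (w.2 s j : EReal) ≤ γ s j)}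

/-- The coercivity condition: there is `r > 0` such that at each feasible point, for each O/D pair
and each of its pairs of users whose demand exceeds `r`, some path of the O/D pair carries a
positive flow and has a dis-utility at least that of this pair of users. -/
def Coercive [Fintype A] (N : ElasticNetwork V A U)
    (γ : (s : N.odPairs) → N.users s → EReal)
    (c : A → (A → ℝ) → ℝ) (h : (s : N.odPairs) → N.users s → N.Demand → ℝ) : Prop :=
  ∃ r : ℝ, 0 < r ∧ ∀ w ∈ N.feasibleSet γ, ∀ s, ∀ j : N.users s, r < w.2 s j →
    ∃ p : N.paths s, 0 < w.1 s p ∧ h s j w.2 ≤ N.pathCost c w.1 s p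

/-- `w` solves the variational inequality of the network equilibrium problem. -/
def SolvesVI [Fintype A] (N : ElasticNetwork V A U)
    (γ : (s : N.odPairs) → N.users s → EReal)
    (c : A → (A → ℝ) → ℝ) (h : (s : N.odPairs) → N.users s → N.Demand → ℝ)
    (w : N.PathFlow × N.Demand) : Prop :=
  w ∈ N.feasibleSet γ ∧ ∀ v ∈ N.feasibleSet γ,
    0 ≤ (∑ s, ∑ p, N.pathCost c w.1 s p * (v.1 s p - w.1 s p))
      - ∑ s, ∑ j, h s j w.2 * (v.2 s j - w.2 s j)

end ElasticNetwork

/-!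
Truncating the upper bounds of the demands just above the coercivity radius makes the feasible set
compact and convex, so that the variational inequality has a solution there: Scarf's combinatorial
lemma yields a dual form of the Knaster–Kuratowski–Mazurkiewicz theorem, this yields variational
inequalities on simplices, and Ky Fan's argument by finite subfamilies passes to compact convex
sets. The solution also solves the problem with the original bounds: a demand at the truncation
level lies above the coercivity radius, so any further increase of it, together with the flow
serving it, can be withdrawn along a used path costing at least as much, which does not increase
the value of the variational inequality and leaves a direction feasible for the truncated problem.
-/

section Parity

open Finset

theorem card_filter_image_erase_eq_two {α β : Type*} [DecidableEq α] [DecidableEq β]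
    {s : Finset α} {t : Finset β} {f : α → β} (hf : s.image f = t) (hcard : #s = #t + 1) :
    #{x ∈ s | (s.erase x).image f = t} = 2 := by
  obtain ⟨x, hx, y, hy, hxy, hfxy⟩ : ∃ x ∈ s, ∃ y ∈ s, x ≠ y ∧ f x = f y :=
    exists_ne_map_eq_of_card_lt_of_maps_to (by lia) fun z hz => hf ▸ mem_image_of_mem f hz
  have image_erase : ∀ {u v}, u ∈ s → v ∈ s → u ≠ v → f u = f v → (s.erase u).image f = t := by
    intro u v hu hv huv hfuv
    rw [← hf, ← insert_erase hu, image_insert, erase_insert (notMem_erase u s), insert_eq_self.2]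
    exact hfuv ▸ mem_image_of_mem f (mem_erase.2 ⟨huv.symm, hv⟩)
  suffices {z ∈ s | (s.erase z).image f = t} = {x, y} by rw [this, card_pair hxy]
  ext z
  rw [mem_filter, mem_insert, mem_singleton]
  constructor
  · rintro ⟨hz, hzt⟩
    have hinj : Set.InjOn f (s.erase z : Finset α) := by
      rw [← card_image_iff, hzt, card_erase_of_mem hz, hcard, Nat.add_sub_cancel]
    by_contra! hne
    exact hxy (hinj (mem_erase.2 ⟨hne.1.symm, hx⟩) (mem_erase.2 ⟨hne.2.symm, hy⟩) hfxy)
  · rintro (rfl | rfl)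
    · exact ⟨hx, image_erase hx hy hxy hfxy⟩
    · exact ⟨hy, image_erase hy hx hxy.symm hfxy.symm⟩

variable {T I : Type*} [Fintype I] [DecidableEq I]

/-- The doors of a colouring `c` with respect to the colour `i₀`, in the sense of the usual proof of
Sperner's lemma: the sets carrying each colour other than `i₀` exactly once. -/
def IsDoor (c : T → I) (i₀ : I) (τ : Finset T) : Prop :=
  #τ + 1 = Fintype.card I ∧ τ.image c = univ.erase i₀

instance (c : T → I) (i₀ : I) : DecidablePred (IsDoor c i₀) := fun _ =>
  inferInstanceAs (Decidable (_ ∧ _))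

theorem even_card_isDoor_subset (c : T → I) (i₀ : I) {R : Finset T} (hR : #R = Fintype.card I)
    (hc : R.image c ≠ univ) : Even #{τ ∈ R.powerset | IsDoor c i₀ τ} := by
  classical
  have doors_eq : {τ ∈ R.powerset | IsDoor c i₀ τ} =
      {x ∈ R | (R.erase x).image c = univ.erase i₀}.image R.erase := by
    ext τ
    simp only [mem_filter, mem_powerset, mem_image]
    constructor
    · rintro ⟨hτR, hτ, himage⟩
      obtain ⟨x, hx, rfl⟩ := exists_eq_insert_iff.2 ⟨hτR, hτ.trans hR.symm⟩
      exact ⟨x, ⟨mem_insert_self x τ, by rwa [erase_insert hx]⟩, erase_insert hx⟩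
    · rintro ⟨x, ⟨hx, himage⟩, rfl⟩
      exact ⟨erase_subset x R, by rw [card_erase_add_one hx, hR], himage⟩
  rw [doors_eq, card_image_of_injOn ((erase_injOn R).mono (coe_subset.2 (filter_subset _ R)))]
  by_cases himage : R.image c = univ.erase i₀
  · rw [card_filter_image_erase_eq_two himage
      (by rw [hR, card_erase_add_one (mem_univ i₀), card_univ])]
    exact even_two
  · rw [filter_eq_empty_iff.2, card_empty]
    · exact Even.zero
    intro x _ hx
    have hsub : univ.erase i₀ ⊆ R.image c := hx ▸ image_subset_image (erase_subset x R)
    have hi₀ : i₀ ∉ R.image c := fun h => hc <| univ_subset_iff.1 <|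
      insert_erase (mem_univ i₀) ▸ insert_subset h hsub
    exact himage ((subset_erase.2 ⟨subset_univ _, hi₀⟩).antisymm hsub)

theorem exists_image_eq_univ_of_isDoor [Finite T] [DecidableEq T] {c : T → I} {i₀ : I}
    {rooms : Finset (Finset T)} (hcard : ∀ R ∈ rooms, #R = Fintype.card I) {τ₀ : Finset T}
    (hτ₀ : IsDoor c i₀ τ₀) (hodd : Odd #{R ∈ rooms | τ₀ ⊆ R})
    (heven : ∀ τ, IsDoor c i₀ τ → τ ≠ τ₀ → Even #{R ∈ rooms | τ ⊆ R}) :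
    ∃ R ∈ rooms, R.image c = univ := by
  cases nonempty_fintype T
  by_contra! hno
  have hrooms : Even (∑ R ∈ rooms, #{τ | IsDoor c i₀ τ ∧ τ ⊆ R}) := by
    refine even_sum _ fun R hR => ?_
    have hfilter : ({τ | IsDoor c i₀ τ ∧ τ ⊆ R} : Finset (Finset T)) =
        {τ ∈ R.powerset | IsDoor c i₀ τ} := by
      ext τ
      simp only [mem_filter, mem_univ, true_and, mem_powerset, and_comm]
    exact hfilter ▸ even_card_isDoor_subset c i₀ (hcard R hR) (hno R hR)
  have hdoors : Odd (∑ τ with IsDoor c i₀ τ, #{R ∈ rooms | τ ⊆ R}) := by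
    rw [← add_sum_erase _ _ (mem_filter_univ τ₀ |>.2 hτ₀)]
    refine hodd.add_even (even_sum _ fun τ hτ => ?_)
    obtain ⟨hne, hdoor⟩ := mem_erase.1 hτ
    exact heven τ ((mem_filter_univ τ).1 hdoor) hne
  have double_count := sum_card_bipartiteAbove_eq_sum_card_bipartiteBelow
    (s := {τ | IsDoor c i₀ τ}) (t := rooms) fun τ R => τ ⊆ R
  simp only [bipartiteAbove, bipartiteBelow, filter_filter] at double_count
  exact Nat.not_even_iff_odd.2 (double_count ▸ hdoors) hrooms

end Parity

section Scarf

open Finset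

variable {T I α : Type*}

/-- A set is dominating, in the sense of Scarf, if no point lies strictly above all of its points
for every one of the (pre)orders given by the `r i`. The dominating sets of `Fintype.card I` points
replace the simplices of a triangulation. -/
def IsDominating [LE α] (r : I → T → α) (R : Finset T) : Prop :=
  ∀ y, ∃ i, ∀ x ∈ R, r i y ≤ r i x

theorem IsDominating.mono [LE α] {r : I → T → α} {R S : Finset T} (hR : IsDominating r R)
    (hS : S ⊆ R) : IsDominating r S := fun y =>
  (hR y).imp fun _ hi x hx => hi x (hS hx)

/-- `m i` is a point of `R` at which `r i` is minimal, for each `i`. -/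
def IsMinimizer [LE α] (r : I → T → α) (R : Finset T) (m : I → T) : Prop :=
  ∀ i, m i ∈ R ∧ ∀ x ∈ R, r i (m i) ≤ r i x

variable [LinearOrder α] {r : I → T → α}

theorem exists_isMinimizer (r : I → T → α) {R : Finset T} (hR : R.Nonempty) :
    ∃ m, IsMinimizer r R m :=
  ⟨_, fun i => (exists_min_image R (r i) hR).choose_spec⟩

theorem IsMinimizer.eq_of_forall_le {R : Finset T} {m : I → T} (hm : IsMinimizer r R m)
    (hr : ∀ i, Function.Injective (r i)) {i : I} {x : T} (hx : x ∈ R)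
    (hmin : ∀ t ∈ R, r i x ≤ r i t) : m i = x :=
  hr i (((hm i).2 x hx).antisymm (hmin _ (hm i).1))

variable [Fintype I]

theorem IsDominating.image_isMinimizer [DecidableEq T] {R : Finset T} (hR : IsDominating r R)
    (hr : ∀ i, Function.Injective (r i)) {m : I → T} (hm : IsMinimizer r R m) :
    univ.image m = R := by
  ext x
  simp only [mem_image, mem_univ, true_and]
  constructor
  · rintro ⟨i, rfl⟩
    exact (hm i).1
  · intro hx
    obtain ⟨i, hi⟩ := hR x
    exact ⟨i, hm.eq_of_forall_le hr hx hi⟩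

theorem IsDominating.eq_of_forall_le {R : Finset T} (hR : IsDominating r R)
    (hr : ∀ i, Function.Injective (r i)) (hcard : #R = Fintype.card I) {x : T} (hx : x ∈ R)
    {i j : I} (hi : ∀ t ∈ R, r i x ≤ r i t) (hj : ∀ t ∈ R, r j x ≤ r j t) : i = j := by
  classical
  obtain ⟨m, hm⟩ := exists_isMinimizer r ⟨x, hx⟩
  have hinj : Set.InjOn m (univ : Finset I) := by
    rw [← card_image_iff, hR.image_isMinimizer hr hm, hcard, card_univ]
  exact hinj (mem_univ i) (mem_univ j)
    ((hm.eq_of_forall_le hr hx hi).trans (hm.eq_of_forall_le hr hx hj).symm)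

section Pivot

variable [DecidableEq T] {τ : Finset T} {m : I → T} {k : I}

/-- The new point is chosen as high as possible for `r k` among the points above the minima for the
other orders. -/
theorem IsDominating.exists_insert [Finite T] [DecidableEq I] (hτ : IsDominating r τ)
    (hm : IsMinimizer r τ m) (hk : (univ.erase k).image m = τ)
    (habove : ∃ y, ∀ l ≠ k, r l (m l) < r l y) :
    ∃ x ∉ τ, IsDominating r (insert x τ) ∧ ∀ t ∈ insert x τ, r k x ≤ r k t := by
  cases nonempty_fintype T
  obtain ⟨x, hx, hmax⟩ := Finset.exists_max_image {y | ∀ l ≠ k, r l (m l) < r l y} (r k)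
    (habove.imp fun y hy => (mem_filter_univ y).2 hy)
  simp only [mem_filter_univ] at hx hmax
  have hxτ : x ∉ τ := by
    rw [← hk, mem_image]
    rintro ⟨l, hl, rfl⟩
    exact (hx l (ne_of_mem_erase hl)).false
  have hmin : ∀ t ∈ insert x τ, r k x ≤ r k t := by
    obtain ⟨l, hl⟩ := hτ x
    obtain rfl : l = k := by
      by_contra hlk
      exact (hx l hlk).not_ge (hl _ (hm l).1)
    exact (forall_mem_insert ..).2 ⟨le_rfl, hl⟩
  refine ⟨x, hxτ, fun y => ?_, hmin⟩
  by_cases hy : ∀ l ≠ k, r l (m l) < r l y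
  · exact ⟨k, fun t ht => (hmax y hy).trans (hmin t ht)⟩
  · push Not at hy
    obtain ⟨l, hlk, hly⟩ := hy
    exact ⟨l, (forall_mem_insert ..).2
      ⟨hly.trans (hx l hlk).le, fun t ht => hly.trans ((hm l).2 t ht)⟩⟩

theorem IsDominating.lt_of_insert (hr : ∀ i, Function.Injective (r i)) (hm : IsMinimizer r τ m)
    {x : T} (hx : IsDominating r (insert x τ)) (hcard : #(insert x τ) = Fintype.card I)
    (hmin : ∀ t ∈ insert x τ, r k x ≤ r k t) {l : I} (hl : l ≠ k) : r l (m l) < r l x := by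
  by_contra! hle
  exact hl (hx.eq_of_forall_le hr hcard (mem_insert_self x τ)
    ((forall_mem_insert ..).2 ⟨le_rfl, fun t ht => hle.trans ((hm l).2 t ht)⟩) hmin)

theorem IsDominating.insert_le_insert (hr : ∀ i, Function.Injective (r i))
    (hm : IsMinimizer r τ m) {x y : T} (hx : IsDominating r (insert x τ))
    (hy : IsDominating r (insert y τ)) (hycard : #(insert y τ) = Fintype.card I)
    (hymin : ∀ t ∈ insert y τ, r k y ≤ r k t) : r k y ≤ r k x := by
  obtain ⟨l, hl⟩ := hx y
  obtain rfl : l = k := by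
    by_contra hlk
    exact (hy.lt_of_insert hr hm hycard hymin hlk).not_ge (hl _ (mem_insert_of_mem (hm l).1))
  exact hl x (mem_insert_self x τ)

theorem IsDominating.image_erase_of_insert [DecidableEq I] (hr : ∀ i, Function.Injective (r i))
    (hm : IsMinimizer r τ m) {x : T} (hxτ : x ∉ τ) (hx : IsDominating r (insert x τ))
    (hmin : ∀ t ∈ insert x τ, r k x ≤ r k t) : (univ.erase k).image m = τ := by
  refine Subset.antisymm (image_subset_iff.2 fun l _ => (hm l).1) fun t ht => ?_
  obtain ⟨l, hl⟩ := hx t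
  refine mem_image.2 ⟨l, mem_erase.2 ⟨?_, mem_univ l⟩,
    hm.eq_of_forall_le hr ht fun u hu => hl u (mem_insert_of_mem hu)⟩
  rintro rfl
  exact hxτ (hr l ((hmin t (mem_insert_of_mem ht)).antisymm (hl x (mem_insert_self x τ))) ▸ ht)

/-- The directions `k` in which `τ` can be completed to a dominating set of `Fintype.card I` points
are the two at which the minimizers of `τ` coincide. -/
theorem IsDominating.card_supersets_eq_two [Fintype T] [DecidablePred (IsDominating r)]
    (hr : ∀ i, Function.Injective (r i)) (hτ : IsDominating r τ)
    (hcard : #τ + 1 = Fintype.card I) (hm : IsMinimizer r τ m)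
    (habove : ∀ k, ∃ y, ∀ l ≠ k, r l (m l) < r l y) :
    #{R | (#R = Fintype.card I ∧ IsDominating r R) ∧ τ ⊆ R} = 2 := by
  classical
  have card_insert {x : T} (hx : x ∉ τ) : #(insert x τ) = Fintype.card I := by
    rw [card_insert_of_notMem hx, hcard]
  let directions : Finset I := {k | (univ.erase k).image m = τ}
  have mem_directions {k : I} : k ∈ directions ↔ (univ.erase k).image m = τ := mem_filter_univ k
  have card_directions : #directions = 2 :=
    card_filter_image_erase_eq_two (hτ.image_isMinimizer hr hm) (by rw [card_univ, hcard])
  choose x hxτ hxdom hxmin using fun k (hk : k ∈ directions) =>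
    hτ.exists_insert hm (mem_directions.1 hk) (habove k)
  rw [← card_directions]
  refine (card_bij (fun k hk => insert (x k hk) τ) (fun k hk => ?_) (fun k hk l hl heq => ?_)
    fun R hR => ?_).symm
  · exact (mem_filter_univ _).2
      ⟨⟨card_insert (hxτ k hk), hxdom k hk⟩, subset_insert _ _⟩
  · have hx : x k hk = x l hl := (insert_inj (hxτ k hk)).1 heq
    exact (hxdom k hk).eq_of_forall_le hr (card_insert (hxτ k hk)) (mem_insert_self _ _)
      (hxmin k hk) (hx ▸ hxmin l hl)
  · obtain ⟨⟨hRcard, hRdom⟩, hτR⟩ := (mem_filter_univ R).1 hR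
    obtain ⟨z, hzτ, rfl⟩ := exists_eq_insert_iff.2 ⟨hτR, hcard.trans hRcard.symm⟩
    obtain ⟨k, hzmin⟩ := hRdom z
    have hk : k ∈ directions := mem_directions.2 (hRdom.image_erase_of_insert hr hm hzτ hzmin)
    refine ⟨k, hk, congrArg (insert · τ) (hr k (le_antisymm ?_ ?_))⟩
    · exact hRdom.insert_le_insert hr hm (hxdom k hk) (card_insert (hxτ k hk)) (hxmin k hk)
    · exact (hxdom k hk).insert_le_insert hr hm hRdom hRcard hzmin

theorem even_card_isDominating_supersets [Fintype T] [DecidablePred (IsDominating r)]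
    (hr : ∀ i, Function.Injective (r i)) (hne : τ.Nonempty) (hcard : #τ + 1 = Fintype.card I)
    (habove : ∀ k, ∃ y, ∀ l ≠ k, ∃ t ∈ τ, r l t < r l y) :
    Even #{R | (#R = Fintype.card I ∧ IsDominating r R) ∧ τ ⊆ R} := by
  by_cases hτ : IsDominating r τ
  · obtain ⟨m, hm⟩ := exists_isMinimizer r hne
    rw [hτ.card_supersets_eq_two hr hcard hm fun k => (habove k).imp fun y hy l hl =>
      (hy l hl).elim fun t ht => ((hm l).2 t ht.1).trans_lt ht.2]
    exact even_two
  · rw [filter_eq_empty_iff.2 fun R _ hR => hτ (hR.1.2.mono hR.2), card_empty]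
    exact Even.zero

end Pivot

/-- Slack points for the family `r`, in the sense of Scarf: `s i` is the lowest point for `r i`, and
the other slack points are higher for `r i` than all points that are not slack. -/
structure IsSlackFamily [LT α] (r : I → T → α) (s : I → T) : Prop where
  slack_lt : ∀ i t, t ≠ s i → r i (s i) < r i t
  lt_slack : ∀ i j t, j ≠ i → t ∉ Set.range s → r i t < r i (s j)

variable [DecidableEq I] {s : I → T}

theorem IsSlackFamily.exists_lt [DecidableEq T] (hs : IsSlackFamily r s)
    (hinj : Function.Injective s) {τ : Finset T} {k l : I} (hlk : l ≠ k)
    (hτ : ¬ τ ⊆ (univ.erase l).image s) :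
    ∃ t ∈ τ, r l t < r l (s k) := by
  by_contra! hle
  refine hτ fun t ht => ?_
  obtain ⟨q, rfl⟩ : t ∈ Set.range s := by
    by_contra htop
    exact (hs.lt_slack l k t hlk.symm htop).not_ge (hle t ht)
  refine mem_image_of_mem s (mem_erase.2 ⟨?_, mem_univ q⟩)
  rintro rfl
  exact (hs.slack_lt q (s k) (hinj.ne hlk.symm)).not_ge (hle (s q) ht)

theorem IsSlackFamily.isDominating_insert [DecidableEq T] (hs : IsSlackFamily r s) {i₀ : I} {a : T}
    (hmax : ∀ y ∉ (univ.erase i₀).image s, r i₀ y ≤ r i₀ a) :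
    IsDominating r (insert a ((univ.erase i₀).image s)) := by
  intro y
  by_cases hy : y ∈ (univ.erase i₀).image s
  · obtain ⟨j, -, rfl⟩ := mem_image.1 hy
    refine ⟨j, fun x _ => ?_⟩
    rcases eq_or_ne x (s j) with rfl | hx
    · exact le_rfl
    · exact (hs.slack_lt j x hx).le
  · refine ⟨i₀, (forall_mem_insert ..).2 ⟨hmax y hy, fun x hx => ?_⟩⟩
    by_cases hyr : y ∈ Set.range s
    · obtain ⟨q, rfl⟩ := hyr
      obtain rfl : q = i₀ := by
        by_contra hq
        exact hy (mem_image_of_mem s (mem_erase.2 ⟨hq, mem_univ q⟩))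
      exact (hs.slack_lt q x fun h => hy (h ▸ hx)).le
    · obtain ⟨j, hj, rfl⟩ := mem_image.1 hx
      exact (hs.lt_slack i₀ j y (ne_of_mem_erase hj) hyr).le

theorem IsSlackFamily.card_supersets_eq_one [Fintype T] [DecidableEq T]
    [DecidablePred (IsDominating r)] (hs : IsSlackFamily r s) (hinj : Function.Injective s)
    (hr : ∀ i, Function.Injective (r i)) (i₀ : I) :
    #{R | (#R = Fintype.card I ∧ IsDominating r R) ∧ (univ.erase i₀).image s ⊆ R} = 1 := by
  set τ₀ := (univ.erase i₀).image s with hτ₀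
  have hcard : #τ₀ + 1 = Fintype.card I := by
    rw [card_image_of_injective _ hinj, card_erase_add_one (mem_univ i₀), card_univ]
  have hslack : s i₀ ∉ τ₀ := fun h => by
    obtain ⟨j, hj, hji⟩ := mem_image.1 h
    exact ne_of_mem_erase hj (hinj hji)
  obtain ⟨a, ha, hmax⟩ := exists_max_image τ₀ᶜ (r i₀) ⟨s i₀, mem_compl.2 hslack⟩
  simp only [mem_compl] at ha hmax
  refine card_eq_one.2 ⟨insert a τ₀, ?_⟩
  ext R
  rw [mem_filter_univ, mem_singleton]
  constructor
  · rintro ⟨⟨hRcard, hRdom⟩, hτ₀R⟩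
    obtain ⟨z, hz, rfl⟩ := exists_eq_insert_iff.2 ⟨hτ₀R, hcard.trans hRcard.symm⟩
    obtain ⟨i, hi⟩ := hRdom a
    obtain rfl : i = i₀ := by
      by_contra hne
      have hsi : s i ∈ τ₀ := mem_image_of_mem s (mem_erase.2 ⟨hne, mem_univ i⟩)
      exact (hs.slack_lt i a fun h => ha (h ▸ hsi)).not_ge (hi _ (mem_insert_of_mem hsi))
    rw [hr i ((hmax z hz).antisymm (hi z (mem_insert_self z τ₀)))]
  · rintro rfl
    exact ⟨⟨by rw [card_insert_of_notMem ha, hcard], hs.isDominating_insert hmax⟩,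
      subset_insert a τ₀⟩

theorem IsDoor.not_subset_image [DecidableEq T] {c : T → I} (hc : Function.LeftInverse c s) {i₀ : I}
    {τ : Finset T} (hτ : IsDoor c i₀ τ) (hne : τ ≠ (univ.erase i₀).image s) (l : I) :
    ¬ τ ⊆ (univ.erase l).image s := by
  intro hl
  have himage : univ.erase i₀ ⊆ univ.erase l := by
    rw [← hτ.2]
    refine (image_subset_image hl).trans_eq ?_
    rw [image_image, hc.comp_eq_id, image_id]
  obtain rfl : l = i₀ := by
    by_contra hli
    exact notMem_erase l univ (himage (mem_erase.2 ⟨hli, mem_univ l⟩))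
  refine hne (eq_of_subset_of_card_le hl ?_)
  rw [card_image_of_injective _ hc.injective, card_erase_of_mem (mem_univ l), card_univ, ← hτ.1,
    Nat.add_sub_cancel]

theorem IsSlackFamily.exists_isDominating_image_eq_univ_of_injective [Finite T] [Nonempty I]
    (hs : IsSlackFamily r s) (hr : ∀ i, Function.Injective (r i)) {c : T → I}
    (hc : Function.LeftInverse c s) :
    ∃ R, #R = Fintype.card I ∧ IsDominating r R ∧ R.image c = univ := by
  classical
  cases nonempty_fintype T
  obtain ⟨i₀⟩ := ‹Nonempty I›
  have hdoor : IsDoor c i₀ ((univ.erase i₀).image s) := by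
    refine ⟨?_, by rw [image_image, hc.comp_eq_id, image_id]⟩
    rw [card_image_of_injective _ hc.injective, card_erase_add_one (mem_univ i₀), card_univ]
  suffices ∃ R ∈ ({R | #R = Fintype.card I ∧ IsDominating r R} : Finset (Finset T)),
      R.image c = univ by
    obtain ⟨R, hR, hRc⟩ := this
    exact ⟨R, ((mem_filter_univ R).1 hR).1, ((mem_filter_univ R).1 hR).2, hRc⟩
  refine exists_image_eq_univ_of_isDoor (fun R hR => ((mem_filter_univ R).1 hR).1) hdoor ?_ ?_
  · rw [filter_filter, hs.card_supersets_eq_one hc.injective hr]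
    exact odd_one
  · intro τ hτ hne
    have hnot_subset := hτ.not_subset_image hc hne
    have hτne : τ.Nonempty := nonempty_iff_ne_empty.2 fun hempty =>
      hnot_subset i₀ (hempty ▸ empty_subset _)
    rw [filter_filter]
    exact even_card_isDominating_supersets hr hτne hτ.1 fun k =>
      ⟨s k, fun l hl => hs.exists_lt hc.injective hl (hnot_subset l)⟩

/-- Ties are broken by an enumeration of the points. -/
theorem IsSlackFamily.exists_isDominating_image_eq_univ [Finite T] [Nonempty I]
    (hs : IsSlackFamily r s) {c : T → I} (hc : Function.LeftInverse c s) :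
    ∃ R, #R = Fintype.card I ∧ IsDominating r R ∧ R.image c = univ := by
  obtain ⟨n, ⟨e⟩⟩ := Finite.exists_equiv_fin T
  let r' : I → T → α ×ₗ Fin n := fun i t => toLex (r i t, e t)
  have hr' : ∀ i, Function.Injective (r' i) := fun i x y hxy =>
    e.injective (congrArg Prod.snd (toLex.injective hxy))
  have hs' : IsSlackFamily r' s :=
    ⟨fun i t ht => Prod.Lex.toLex_lt_toLex.2 (Or.inl (hs.slack_lt i t ht)),
      fun i j t hj ht => Prod.Lex.toLex_lt_toLex.2 (Or.inl (hs.lt_slack i j t hj ht))⟩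
  obtain ⟨R, hcard, hdom, hRc⟩ := hs'.exists_isDominating_image_eq_univ_of_injective hr' hc
  refine ⟨R, hcard, fun y => ?_, hRc⟩
  obtain ⟨i, hi⟩ := hdom y
  exact ⟨i, fun x hx => (Prod.Lex.toLex_le_toLex.1 (hi x hx)).elim le_of_lt fun h => h.1.le⟩

end Scarf

section KnasterKuratowskiMazurkiewicz

open Set Filter Topology

variable {I : Type*} [Fintype I]

theorem exists_forall_lt_of_forall_exists_dist_lt [Nonempty I] {G : Set (I → ℝ)} {η : ℝ}
    (hG : ∀ y ∈ stdSimplex ℝ I, ∃ g ∈ G, dist y g < η) {μ : I → ℝ} (hμ : ∀ i, -η ≤ μ i)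
    (hsum : ∑ i, μ i + Fintype.card I * η ≤ 1) : ∃ g ∈ G, ∀ i, μ i < g i := by
  set n : ℝ := (Fintype.card I : ℝ)
  have hn : 0 < n := Nat.cast_pos.2 Fintype.card_pos
  set d := (1 - (∑ i, μ i + n * η)) / n with hd
  have hd_nonneg : 0 ≤ d := div_nonneg (sub_nonneg.2 hsum) hn.le
  obtain ⟨g, hg, hdist⟩ := hG (fun i => μ i + (η + d)) ⟨fun i => by linarith [hμ i], by
    rw [Finset.sum_add_distrib, Finset.sum_const, Finset.card_univ, nsmul_eq_mul, hd]
    field_simp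
    ring⟩
  refine ⟨g, hg, fun i => ?_⟩
  have hi : |μ i + (η + d) - g i| < η := (dist_le_pi_dist _ g i).trans_lt hdist
  linarith [(abs_lt.1 hi).2]

/-- The coordinates of the points of a set `G`, to which one slack point per coordinate is added:
in the simplex, the slack point `Sum.inl j` is below all points in coordinate `j` and above all
points in the other coordinates. -/
def slackHeight [DecidableEq I] (η : ℝ) (G : Set (I → ℝ)) (i : I) : I ⊕ G → ℝ :=
  Sum.elim (fun j => if j = i then -η else 2) fun g => g.1 i

theorem isSlackFamily_slackHeight [DecidableEq I] {η : ℝ} (hη : 0 < η) {G : Set (I → ℝ)}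
    (hG : G ⊆ stdSimplex ℝ I) : IsSlackFamily (slackHeight η G) Sum.inl := by
  constructor
  · rintro i (j | g) ht
    · have hji : j ≠ i := fun h => ht (congrArg _ h)
      simp only [slackHeight, Sum.elim_inl, if_true, if_neg hji]
      linarith
    · simp only [slackHeight, Sum.elim_inl, Sum.elim_inr, if_true]
      linarith [(hG g.2).1 i]
  · rintro i j (k | g) hji ht
    · exact absurd (mem_range_self k) ht
    · simp only [slackHeight, Sum.elim_inl, Sum.elim_inr, if_neg hji]
      linarith [(mem_Icc_of_mem_stdSimplex (hG g.2) i).2]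

theorem neg_le_slackHeight [DecidableEq I] {η : ℝ} (hη : 0 < η) {G : Set (I → ℝ)}
    (hG : G ⊆ stdSimplex ℝ I) (i : I) (t : I ⊕ G) : -η ≤ slackHeight η G i t := by
  rcases eq_or_ne t (Sum.inl i) with rfl | ht
  · simp only [slackHeight, Sum.elim_inl, if_true, le_refl]
  · refine le_trans ?_ ((isSlackFamily_slackHeight hη hG).slack_lt i t ht).le
    simp only [slackHeight, Sum.elim_inl, if_true, le_refl]

theorem one_lt_sum_slackHeight_add [DecidableEq I] [Nonempty I] {η : ℝ} (hη : 0 < η)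
    {G : Set (I → ℝ)} (hG : G ⊆ stdSimplex ℝ I)
    (hnet : ∀ y ∈ stdSimplex ℝ I, ∃ g ∈ G, dist y g < η) {R : Finset (I ⊕ G)}
    (hR : IsDominating (slackHeight η G) R) {m : I → I ⊕ G} (hm : ∀ i, m i ∈ R) :
    1 < ∑ i, slackHeight η G i (m i) + Fintype.card I * η := by
  by_contra! hle
  obtain ⟨g, hg, hlt⟩ := exists_forall_lt_of_forall_exists_dist_lt hnet
    (fun i => neg_le_slackHeight hη hG i (m i)) hle
  obtain ⟨i, hi⟩ := hR (Sum.inr ⟨g, hg⟩)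
  exact (hlt i).not_ge (hi _ (hm i))

theorem le_add_of_forall_le_of_sum_le {μ b : I → ℝ} {δ : ℝ} (hle : ∀ i, μ i ≤ b i)
    (hsum : ∑ i, b i ≤ ∑ i, μ i + δ) (i : I) : b i ≤ μ i + δ := by
  classical
  have hrest : ∑ j ∈ Finset.univ.erase i, μ j ≤ ∑ j ∈ Finset.univ.erase i, b j :=
    Finset.sum_le_sum fun j _ => hle j
  rw [← Finset.add_sum_erase _ b (Finset.mem_univ i),
    ← Finset.add_sum_erase _ μ (Finset.mem_univ i)] at hsum
  linarith

/-- A dominating set of points near each other, one of each colour, where a slack point of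
colour `i` forces the `i`-th coordinates to be small. -/
theorem exists_forall_le_or_exists_dist_le [Nonempty I] (c : (I → ℝ) → I) {δ : ℝ} (hδ : 0 < δ) :
    ∃ a ∈ stdSimplex ℝ I, ∀ i, a i ≤ δ ∨ ∃ b ∈ stdSimplex ℝ I, c b = i ∧ dist a b ≤ δ := by
  classical
  set n : ℝ := (Fintype.card I : ℝ)
  have hn : 0 < n := Nat.cast_pos.2 Fintype.card_pos
  set η := δ / n
  have hη : 0 < η := div_pos hδ hn
  have hnη : n * η = δ := mul_div_cancel₀ δ hn.ne'
  obtain ⟨G, hG, hGfin, hcover⟩ := (isCompact_stdSimplex ℝ I).finite_cover_balls hη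
  have hnet : ∀ y ∈ stdSimplex ℝ I, ∃ g ∈ G, dist y g < η := fun y hy => by
    simpa only [mem_iUnion, exists_prop, Metric.mem_ball] using hcover hy
  have : Finite G := hGfin
  obtain ⟨R, -, hRdom, hRimage⟩ :=
    (isSlackFamily_slackHeight hη hG).exists_isDominating_image_eq_univ
      (c := Sum.elim id fun g => c g.1) fun _ => rfl
  have hcolour : ∀ i, ∃ t ∈ R, Sum.elim id (fun g : G => c g.1) t = i := fun i =>
    Finset.mem_image.1 (hRimage ▸ Finset.mem_univ i)
  obtain ⟨m, hm⟩ := exists_isMinimizer (slackHeight η G)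
    ((hcolour (Classical.arbitrary I)).imp fun _ h => h.1)
  set μ : I → ℝ := fun i => slackHeight η G i (m i)
  have hμsum : 1 < ∑ i, μ i + n * η := one_lt_sum_slackHeight_add hη hG hnet hRdom fun i => (hm i).1
  have hμle {g : G} (hg : Sum.inr g ∈ R) (i : I) : μ i ≤ g.1 i := (hm i).2 _ hg
  have hleμ {g : G} (hg : Sum.inr g ∈ R) (i : I) : g.1 i ≤ μ i + δ :=
    le_add_of_forall_le_of_sum_le (hμle hg) (by rw [(hG g.2).2, ← hnη]; exact hμsum.le) i
  have hμslack {i : I} (hi : Sum.inl i ∈ R) : μ i ≤ -η := ((hm i).2 _ hi).trans_eq (if_pos rfl)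
  obtain ⟨g, hg⟩ : ∃ g : G, Sum.inr g ∈ R := by
    by_contra! hno
    have hμ_nonpos : ∑ i, μ i ≤ ∑ _i : I, -η := Finset.sum_le_sum fun i _ => by
      obtain ⟨j | g, ht, rfl⟩ := hcolour i
      · exact hμslack ht
      · exact absurd ht (hno g)
    rw [Finset.sum_const, Finset.card_univ, nsmul_eq_mul] at hμ_nonpos
    linarith
  refine ⟨g, hG g.2, fun i => ?_⟩
  obtain ⟨j | b, ht, rfl⟩ := hcolour i
  · exact Or.inl ((hleμ hg j).trans (by linarith [hμslack ht]))
  · refine Or.inr ⟨b, hG b.2, rfl, (dist_pi_le_iff hδ.le).2 fun k => abs_sub_le_iff.2 ?_⟩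
    constructor <;> linarith [hμle hg k, hleμ hg k, hμle ht k, hleμ ht k]

theorem exists_forall_eq_zero_or_mem_of_stdSimplex_subset_iUnion [Nonempty I]
    {C : I → Set (I → ℝ)} (hclosed : ∀ i, IsClosed (C i)) (hcover : stdSimplex ℝ I ⊆ ⋃ i, C i) :
    ∃ z ∈ stdSimplex ℝ I, ∀ i, z i = 0 ∨ z ∈ C i := by
  have hcolour : ∀ x : I → ℝ, ∃ i, x ∈ stdSimplex ℝ I → x ∈ C i := fun x => by
    by_cases hx : x ∈ stdSimplex ℝ I
    · exact (mem_iUnion.1 (hcover hx)).imp fun i hi _ => hi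
    · exact ⟨Classical.arbitrary I, fun h => absurd h hx⟩
  choose c hc using hcolour
  choose a haΔ ha using fun k : ℕ =>
    exists_forall_le_or_exists_dist_le c (Nat.one_div_pos_of_nat (α := ℝ) (n := k))
  obtain ⟨z, hz, φ, hφ, hlim⟩ := (isCompact_stdSimplex ℝ I).tendsto_subseq haΔ
  have hδ : Tendsto (fun k => 1 / ((φ k : ℝ) + 1)) atTop (𝓝 0) :=
    tendsto_one_div_add_atTop_nhds_zero_nat.comp hφ.tendsto_atTop
  refine ⟨z, hz, fun i => or_iff_not_imp_left.2 fun hzi => ?_⟩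
  rw [← (hclosed i).closure_eq]
  refine Metric.mem_closure_iff.2 fun ε hε => ?_
  obtain ⟨k, hkdist, hkδ, hkpos⟩ : ∃ k, dist (a (φ k)) z < ε / 2 ∧ 1 / ((φ k : ℝ) + 1) < ε / 2 ∧
      1 / ((φ k : ℝ) + 1) < a (φ k) i :=
    ((hlim.eventually (Metric.ball_mem_nhds z (half_pos hε))).and <|
      (hδ.eventually_lt_const (half_pos hε)).and <|
      hδ.eventually_lt (tendsto_pi_nhds.1 hlim i) ((hz.1 i).lt_of_ne' hzi)).exists
  obtain ⟨b, hb, rfl, hdist⟩ := (ha (φ k) i).resolve_left hkpos.not_ge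
  refine ⟨b, hc b hb, ?_⟩
  linarith [dist_triangle_left z b (a (φ k))]

theorem exists_forall_sum_mul_le [Nonempty I] {φ : I → (I → ℝ) → ℝ}
    (hφ : ∀ i, ContinuousOn (φ i) (stdSimplex ℝ I)) :
    ∃ t ∈ stdSimplex ℝ I, ∀ j, ∑ i, t i * φ i t ≤ φ j t := by
  obtain ⟨t, ht, hmin⟩ := exists_forall_eq_zero_or_mem_of_stdSimplex_subset_iUnion
    (C := fun i => ⋂ j, {t ∈ stdSimplex ℝ I | φ i t ≤ φ j t})
    (fun i => isClosed_iInter fun j => (isClosed_stdSimplex ℝ I).isClosed_le (hφ i) (hφ j))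
    fun t ht => by
      obtain ⟨i, hi⟩ := Finite.exists_min fun i => φ i t
      exact mem_iUnion.2 ⟨i, mem_iInter.2 fun j => ⟨ht, hi j⟩⟩
  refine ⟨t, ht, fun j => ?_⟩
  calc ∑ i, t i * φ i t ≤ ∑ i, t i * φ j t := Finset.sum_le_sum fun i _ => by
        rcases hmin i with hi | hi
        · rw [hi, zero_mul, zero_mul]
        · exact mul_le_mul_of_nonneg_left (mem_iInter.1 hi j).2 (ht.1 i)
    _ = φ j t := by rw [← Finset.sum_mul, ht.2, one_mul]

end KnasterKuratowskiMazurkiewicz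

section VariationalInequality

variable {E : Type*} [AddCommGroup E] [Module ℝ E] [TopologicalSpace E]
  [ContinuousAdd E] [ContinuousSMul ℝ E] {K : Set E}

theorem exists_forall_finset_nonneg_of_convexOn (hconv : Convex ℝ K) (hne : K.Nonempty)
    {Φ : E → E → ℝ} (hcont : ∀ v ∈ K, ContinuousOn (Φ · v) K) (hΦ : ∀ z ∈ K, ConvexOn ℝ K (Φ z))
    (hdiag : ∀ z ∈ K, 0 ≤ Φ z z) (S : Finset E) (hS : ↑S ⊆ K) :
    ∃ z ∈ K, ∀ v ∈ S, 0 ≤ Φ z v := by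
  rcases S.eq_empty_or_nonempty with rfl | hSne
  · exact hne.imp fun z hz => ⟨hz, fun v hv => absurd hv (Finset.notMem_empty v)⟩
  have := hSne.to_subtype
  let z : (S → ℝ) → E := fun t => ∑ v, t v • (v : E)
  have hzK : ∀ t ∈ stdSimplex ℝ S, z t ∈ K := fun t ht =>
    hconv.sum_mem (fun v _ => ht.1 v) ht.2 fun v _ => hS v.2
  have hz : Continuous z := by fun_prop
  obtain ⟨t, ht, hle⟩ := exists_forall_sum_mul_le (I := S) (φ := fun v t => Φ (z t) v)
    fun v => (hcont v (hS v.2)).comp hz.continuousOn hzK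
  refine ⟨z t, hzK t ht, fun v hv => ?_⟩
  calc 0 ≤ Φ (z t) (z t) := hdiag _ (hzK t ht)
    _ ≤ ∑ u : S, t u • Φ (z t) u :=
      (hΦ _ (hzK t ht)).map_sum_le (fun u _ => ht.1 u) ht.2 fun u _ => hS u.2
    _ ≤ Φ (z t) v := hle ⟨v, hv⟩

theorem exists_forall_nonneg_of_convexOn (hK : IsCompact K) (hconv : Convex ℝ K)
    (hne : K.Nonempty) {Φ : E → E → ℝ} (hcont : ∀ v ∈ K, ContinuousOn (Φ · v) K)
    (hΦ : ∀ z ∈ K, ConvexOn ℝ K (Φ z)) (hdiag : ∀ z ∈ K, 0 ≤ Φ z z) :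
    ∃ z ∈ K, ∀ v ∈ K, 0 ≤ Φ z v := by
  classical
  have := isCompact_iff_compactSpace.1 hK
  obtain ⟨z, hz⟩ := CompactSpace.iInter_nonempty (t := fun v : K => {z : K | 0 ≤ Φ z v})
    (fun v => isClosed_le continuous_const (hcont v v.2).domRestrict) fun S => by
      obtain ⟨z, hz, hzS⟩ := exists_forall_finset_nonneg_of_convexOn hconv hne hcont hΦ hdiag
        (S.image (↑)) (by simp)
      exact ⟨⟨z, hz⟩, Set.mem_iInter₂.2 fun v hv => hzS v (Finset.mem_image_of_mem _ hv)⟩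
  exact ⟨z, z.2, fun v hv => Set.mem_iInter.1 hz ⟨v, hv⟩⟩

theorem exists_forall_nonneg_apply_sub (hK : IsCompact K) (hconv : Convex ℝ K)
    (hne : K.Nonempty) {F : E → E →ₗ[ℝ] ℝ} (hF : ∀ v ∈ K, ContinuousOn (fun z => F z (v - z)) K) :
    ∃ z ∈ K, ∀ v ∈ K, 0 ≤ F z (v - z) := by
  refine exists_forall_nonneg_of_convexOn hK hconv hne hF (fun z _ => ?_) fun z _ => ?_
  · exact (((F z).convexOn hconv).add_const (-F z z)).congr fun v _ => by
      rw [Pi.add_apply, map_sub, sub_eq_add_neg]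
  · rw [sub_self, map_zero]

end VariationalInequality

open Filter Topology in
theorem eventually_nonneg_add_mul {a d : ℝ} (ha : 0 ≤ a) (hd : a = 0 → 0 ≤ d) :
    ∀ᶠ ε in 𝓝[>] (0 : ℝ), 0 ≤ a + ε * d := by
  rcases ha.eq_or_lt with rfl | hpos
  · filter_upwards [self_mem_nhdsWithin] with ε hε
    rw [zero_add]
    exact mul_nonneg (le_of_lt hε) (hd rfl)
  · have hlim : Tendsto (fun ε : ℝ => a + ε * d) (𝓝[>] 0) (𝓝 (a + 0 * d)) :=
      (Continuous.tendsto (by fun_prop) 0).mono_left nhdsWithin_le_nhds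
    refine (hlim.eventually_const_lt ?_).mono fun _ => le_of_lt
    rwa [zero_mul, add_zero]

theorem exists_flow_of_pos {P : Type*} [Fintype P] {x g : P → ℝ} {κ : ℝ} {p : P}
    (hp : 0 < x p) (hκ : κ ≤ g p) {e : ℝ} (he : 0 ≤ e) :
    ∃ t : P → ℝ, (∀ q, x q = 0 → t q = 0) ∧ ∑ q, t q = e ∧ κ * e ≤ ∑ q, g q * t q := by
  classical
  refine ⟨Pi.single p e, fun q hq => Pi.single_eq_of_ne (by rintro rfl; exact hp.ne' hq) _,
    Fintype.sum_pi_single' p e, ?_⟩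
  rw [Fintype.sum_eq_single p fun q hq => by rw [Pi.single_eq_of_ne hq, mul_zero],
    Pi.single_eq_same]
  exact mul_le_mul_of_nonneg_right hκ he

namespace ElasticNetwork

open Set Filter Topology

variable {V A U : Type*} (N : ElasticNetwork V A U) {γ γ' : (s : N.odPairs) → N.users s → EReal}

theorem feasibleSet_mono (hγ : ∀ s j, γ s j ≤ γ' s j) : N.feasibleSet γ ⊆ N.feasibleSet γ' :=
  fun _ hw s => ⟨(hw s).1, (hw s).2.1, fun j =>
    ⟨((hw s).2.2 j).1, ((hw s).2.2 j).2.trans (hγ s j)⟩⟩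

theorem zero_mem_feasibleSet (hγ : ∀ s j, 0 ≤ γ s j) : 0 ∈ N.feasibleSet γ := fun s =>
  ⟨by simp, fun _ => le_rfl, fun j => ⟨le_rfl, hγ s j⟩⟩

theorem convex_feasibleSet : Convex ℝ (N.feasibleSet γ) := by
  intro w hw v hv a b ha hb hab s
  obtain ⟨hwbal, hwx, hwy⟩ := hw s
  obtain ⟨hvbal, hvx, hvy⟩ := hv s
  refine ⟨?_, fun p => add_nonneg (mul_nonneg ha (hwx p)) (mul_nonneg hb (hvx p)), fun j =>
    ⟨add_nonneg (mul_nonneg ha (hwy j).1) (mul_nonneg hb (hvy j).1), ?_⟩⟩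
  · simp only [Prod.fst_add, Prod.snd_add, Prod.smul_fst, Prod.smul_snd, Pi.add_apply,
      Pi.smul_apply, smul_eq_mul, Finset.sum_add_distrib, ← Finset.mul_sum, hwbal, hvbal]
  · rcases le_max_iff.1 (Convex.combo_le_max (w.2 s j) (v.2 s j) ha hb hab) with hle | hle
    · exact (EReal.coe_le_coe_iff.2 hle).trans (hwy j).2
    · exact (EReal.coe_le_coe_iff.2 hle).trans (hvy j).2

theorem isClosed_feasibleSet : IsClosed (N.feasibleSet γ) := by
  simp only [feasibleSet, ofPred_forall, ofPred_and]
  refine isClosed_iInter fun s => (isClosed_eq (by fun_prop) (by fun_prop)).inter <|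
    (isClosed_iInter fun p => isClosed_le continuous_const (by fun_prop)).inter <|
    isClosed_iInter fun j => (isClosed_le continuous_const (by fun_prop)).inter <|
    isClosed_le (continuous_coe_real_ereal.comp (by fun_prop)) continuous_const

theorem isCompact_feasibleSet (hγ : ∀ s j, γ s j ≠ ⊤) : IsCompact (N.feasibleSet γ) := by
  refine (isCompact_Icc (a := (0 : N.PathFlow × N.Demand))
    (b := (fun s _ => ∑ j, (γ s j).toReal, fun s j => (γ s j).toReal))).of_isClosed_subset
    N.isClosed_feasibleSet fun w hw => ?_
  have hy : ∀ s j, w.2 s j ≤ (γ s j).toReal := fun s j =>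
    EReal.coe_le_coe_iff.1 (((hw s).2.2 j).2.trans (EReal.le_coe_toReal (hγ s j)))
  refine ⟨⟨fun s p => (hw s).2.1 p, fun s j => ((hw s).2.2 j).1⟩, fun s p => ?_, hy⟩
  calc w.1 s p ≤ ∑ q, w.1 s q :=
        Finset.single_le_sum (fun q _ => (hw s).2.1 q) (Finset.mem_univ p)
    _ = ∑ j, w.2 s j := (hw s).1
    _ ≤ ∑ j, (γ s j).toReal := Finset.sum_le_sum fun j _ => hy s j

theorem exists_add_smul_mem_feasibleSet {r M : ℝ} (hrM : r < M) {w v d : N.PathFlow × N.Demand}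
    (hw : w ∈ N.feasibleSet fun s j => min (γ s j) M) (hv : v ∈ N.feasibleSet γ)
    (hbal : ∀ s, ∑ p, d.1 s p = ∑ j, d.2 s j) (hpath : ∀ s p, w.1 s p = 0 → 0 ≤ d.1 s p)
    (hdemand : ∀ s j, w.2 s j = 0 → 0 ≤ d.2 s j) (hle : ∀ s j, d.2 s j ≤ v.2 s j - w.2 s j)
    (hlarge : ∀ s j, r < w.2 s j → d.2 s j ≤ 0) :
    ∃ ε : ℝ, 0 < ε ∧ w + ε • d ∈ N.feasibleSet fun s j => min (γ s j) M := by
  have hwM (s) (j) : w.2 s j ≤ M :=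
    EReal.coe_le_coe_iff.1 (((hw s).2.2 j).2.trans (min_le_right _ _))
  have hx : ∀ᶠ ε in 𝓝[>] (0 : ℝ), ∀ s p, 0 ≤ w.1 s p + ε * d.1 s p :=
    eventually_all.2 fun s => eventually_all.2 fun p =>
      eventually_nonneg_add_mul ((hw s).2.1 p) (hpath s p)
  have hy : ∀ᶠ ε in 𝓝[>] (0 : ℝ), ∀ s j, 0 ≤ w.2 s j + ε * d.2 s j :=
    eventually_all.2 fun s => eventually_all.2 fun j =>
      eventually_nonneg_add_mul ((hw s).2.2 j).1 (hdemand s j)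
  have hM : ∀ᶠ ε in 𝓝[>] (0 : ℝ), ∀ s j, 0 ≤ M - w.2 s j + ε * -d.2 s j :=
    eventually_all.2 fun s => eventually_all.2 fun j =>
      eventually_nonneg_add_mul (sub_nonneg.2 (hwM s j)) fun h =>
        neg_nonneg.2 (hlarge s j (hrM.trans_eq (sub_eq_zero.1 h)))
  obtain ⟨ε, hεx, hεy, hεM, hε0, hε1⟩ :=
    (hx.and <| hy.and <| hM.and <| Ioc_mem_nhdsGT (zero_lt_one (α := ℝ))).exists
  have hγ : w + ε • (v - w) ∈ N.feasibleSet γ :=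
    N.convex_feasibleSet.add_smul_sub_mem (N.feasibleSet_mono (fun _ _ => min_le_left _ _) hw) hv
      ⟨hε0.le, hε1⟩
  refine ⟨ε, hε0, fun s => ⟨?_, hεx s, fun j => ⟨hεy s j, le_min ?_ ?_⟩⟩⟩
  · simp only [Prod.fst_add, Prod.snd_add, Prod.smul_fst, Prod.smul_snd, Pi.add_apply,
      Pi.smul_apply, smul_eq_mul, Finset.sum_add_distrib, ← Finset.mul_sum, (hw s).1, hbal]
  · refine le_trans (EReal.coe_le_coe_iff.2 ?_) ((hγ s).2.2 j).2
    exact add_le_add_right (mul_le_mul_of_nonneg_left (hle s j) hε0.le) _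
  · refine EReal.coe_le_coe_iff.2 ?_
    change w.2 s j + ε * d.2 s j ≤ M
    linarith [hεM s j]

theorem incidence_nonneg (p : List A) (a : A) : 0 ≤ incidence p a := by
  unfold incidence
  split_ifs <;> norm_num

theorem continuous_arcFlow : Continuous N.arcFlow := by
  unfold arcFlow
  fun_prop

theorem arcFlow_nonneg {x : N.PathFlow} (hx : ∀ s p, 0 ≤ x s p) (a : A) : 0 ≤ N.arcFlow x a :=
  Finset.sum_nonneg fun s _ => Finset.sum_nonneg fun p _ =>
    mul_nonneg (incidence_nonneg p.1 a) (hx s p)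

variable [Fintype A] {c : A → (A → ℝ) → ℝ} {h : (s : N.odPairs) → N.users s → N.Demand → ℝ}

theorem continuousOn_pathCost (hc : ∀ a, ContinuousOn (c a) {f : A → ℝ | ∀ a', 0 ≤ f a'})
    (s : N.odPairs) (p : N.paths s) :
    ContinuousOn (fun x => N.pathCost c x s p) {x | ∀ s p, 0 ≤ x s p} :=
  continuousOn_finsetSum _ fun a _ => continuousOn_const.mul
    ((hc a).comp N.continuous_arcFlow.continuousOn fun _ hx => N.arcFlow_nonneg hx)

variable (c h) in
/-- The operator of the variational inequality of the network equilibrium problem: at the point `w`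
it is the vector of the path dis-utilities and of the negated dis-utilities of the users, seen as a
linear functional. -/
noncomputable def viOperator (w : N.PathFlow × N.Demand) : N.PathFlow × N.Demand →ₗ[ℝ] ℝ where
  toFun v := (∑ s, ∑ p, N.pathCost c w.1 s p * v.1 s p) - ∑ s, ∑ j, h s j w.2 * v.2 s j
  map_add' u v := by
    simp only [Prod.fst_add, Prod.snd_add, Pi.add_apply, mul_add, Finset.sum_add_distrib]
    ring
  map_smul' a v := by
    simp only [Prod.smul_fst, Prod.smul_snd, Pi.smul_apply, smul_eq_mul, mul_left_comm _ a,
      ← Finset.mul_sum, mul_sub, RingHom.id_apply]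

theorem continuousOn_viOperator_sub
    (hc : ∀ a, ContinuousOn (c a) {f : A → ℝ | ∀ a', 0 ≤ f a'})
    (hh : ∀ s j, ContinuousOn (h s j) {y : N.Demand | ∀ s j, 0 ≤ y s j})
    (v : N.PathFlow × N.Demand) :
    ContinuousOn (fun w => N.viOperator c h w (v - w)) (N.feasibleSet γ) := by
  have hcost (s) (p : N.paths s) : ContinuousOn (fun w : N.PathFlow × N.Demand =>
      N.pathCost c w.1 s p) (N.feasibleSet γ) :=
    (N.continuousOn_pathCost hc s p).comp continuousOn_fst fun w hw s => (hw s).2.1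
  have hutility (s) (j : N.users s) : ContinuousOn (fun w : N.PathFlow × N.Demand =>
      h s j w.2) (N.feasibleSet γ) :=
    (hh s j).comp continuousOn_snd fun w hw s j => ((hw s).2.2 j).1
  refine (continuousOn_finsetSum _ fun s _ => continuousOn_finsetSum _ fun p _ =>
    (hcost s p).mul ?_).sub (continuousOn_finsetSum _ fun s _ => continuousOn_finsetSum _ fun j _ =>
    (hutility s j).mul ?_) <;> fun_prop

theorem exists_solvesVI_of_ne_top (hγ : ∀ s j, γ s j ≠ ⊤) (hne : (N.feasibleSet γ).Nonempty)
    (hc : ∀ a, ContinuousOn (c a) {f : A → ℝ | ∀ a', 0 ≤ f a'})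
    (hh : ∀ s j, ContinuousOn (h s j) {y : N.Demand | ∀ s j, 0 ≤ y s j}) :
    ∃ w, N.SolvesVI γ c h w :=
  exists_forall_nonneg_apply_sub (N.isCompact_feasibleSet hγ) N.convex_feasibleSet hne
    (F := N.viOperator c h) fun v _ => N.continuousOn_viOperator_sub hc hh v

theorem exists_pathFlow_viOperator_nonneg {w : N.PathFlow × N.Demand} {e : N.Demand}
    (he : ∀ s j, 0 ≤ e s j)
    (hpath : ∀ s j, e s j ≠ 0 → ∃ p, 0 < w.1 s p ∧ h s j w.2 ≤ N.pathCost c w.1 s p) :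
    ∃ z : N.PathFlow, 0 ≤ N.viOperator c h w (z, e) ∧ (∀ s, ∑ p, z s p = ∑ j, e s j) ∧
      ∀ s p, w.1 s p = 0 → z s p = 0 := by
  have hflow (s) (j : N.users s) : ∃ t : N.paths s → ℝ, (∀ p, w.1 s p = 0 → t p = 0) ∧
      ∑ p, t p = e s j ∧ h s j w.2 * e s j ≤ ∑ p, N.pathCost c w.1 s p * t p := by
    by_cases hj : e s j = 0
    · exact ⟨0, by simp [hj]⟩
    · obtain ⟨p, hp, hpj⟩ := hpath s j hj
      exact exists_flow_of_pos hp hpj (he s j)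
  choose t ht_zero ht_sum ht_cost using hflow
  refine ⟨fun s p => ∑ j, t s j p, sub_nonneg.2 (Finset.sum_le_sum fun s _ => ?_), fun s => ?_,
    fun s p hp => Finset.sum_eq_zero fun j _ => ht_zero s j p hp⟩
  · calc ∑ j, h s j w.2 * e s j ≤ ∑ j, ∑ p, N.pathCost c w.1 s p * t s j p :=
          Finset.sum_le_sum fun j _ => ht_cost s j
      _ = ∑ p, N.pathCost c w.1 s p * ∑ j, t s j p := by
          rw [Finset.sum_comm]
          simp only [Finset.mul_sum]
  · rw [Finset.sum_comm]
    simp only [ht_sum]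

/-- The direction `d` is `v - w` without the increase of the demands that are already large in `w`:
that increase is withdrawn from paths which cost at least as much as it is worth. -/
theorem exists_direction_viOperator_le {r : ℝ} (hr : 0 ≤ r) {w v : N.PathFlow × N.Demand}
    (hw : w ∈ N.feasibleSet γ) (hv : v ∈ N.feasibleSet γ)
    (hcoer : ∀ s j, r < w.2 s j → ∃ p, 0 < w.1 s p ∧ h s j w.2 ≤ N.pathCost c w.1 s p) :
    ∃ d : N.PathFlow × N.Demand, N.viOperator c h w d ≤ N.viOperator c h w (v - w) ∧
      (∀ s, ∑ p, d.1 s p = ∑ j, d.2 s j) ∧ (∀ s p, w.1 s p = 0 → 0 ≤ d.1 s p) ∧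
      (∀ s j, w.2 s j = 0 → 0 ≤ d.2 s j) ∧ (∀ s j, d.2 s j ≤ v.2 s j - w.2 s j) ∧
      ∀ s j, r < w.2 s j → d.2 s j ≤ 0 := by
  let e : N.Demand := fun s j => if r < w.2 s j then max 0 (v.2 s j - w.2 s j) else 0
  have he_nonneg (s) (j) : 0 ≤ e s j := by
    simp only [e]
    split_ifs
    exacts [le_max_left _ _, le_rfl]
  obtain ⟨z, hz, hz_bal, hz_zero⟩ := N.exists_pathFlow_viOperator_nonneg he_nonneg
    fun s j hj => hcoer s j (by_contra fun hr => hj (if_neg hr))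
  refine ⟨v - w - (z, e), ?_, fun s => ?_, fun s p hp => ?_, fun s j hj => ?_, fun s j => ?_,
    fun s j hj => ?_⟩
  · rw [map_sub]
    exact sub_le_self _ hz
  · change ∑ p, (v.1 s p - w.1 s p - z s p) = ∑ j, (v.2 s j - w.2 s j - e s j)
    simp only [Finset.sum_sub_distrib, (hv s).1, (hw s).1, hz_bal]
  · change 0 ≤ v.1 s p - w.1 s p - z s p
    rw [hp, hz_zero s p hp, sub_zero, sub_zero]
    exact (hv s).2.1 p
  · change 0 ≤ v.2 s j - w.2 s j - e s j
    simp only [e, hj, hr.not_gt, if_false, sub_zero]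
    exact ((hv s).2.2 j).1
  · exact sub_le_self _ (he_nonneg s j)
  · change v.2 s j - w.2 s j - e s j ≤ 0
    simp only [e, if_pos hj]
    exact sub_nonpos.2 (le_max_right _ _)

variable {N} in
theorem SolvesVI.of_min {r M : ℝ} (hr : 0 ≤ r) (hrM : r < M) {w : N.PathFlow × N.Demand}
    (hw : N.SolvesVI (fun s j => min (γ s j) M) c h w)
    (hcoer : ∀ s j, r < w.2 s j → ∃ p, 0 < w.1 s p ∧ h s j w.2 ≤ N.pathCost c w.1 s p) :
    N.SolvesVI γ c h w := by
  have hwγ : w ∈ N.feasibleSet γ := N.feasibleSet_mono (fun _ _ => min_le_left _ _) hw.1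
  refine ⟨hwγ, fun v hv => ?_⟩
  obtain ⟨d, hdv, hbal, hpath, hdemand, hle, hlarge⟩ :=
    N.exists_direction_viOperator_le hr hwγ hv hcoer
  obtain ⟨ε, hε, hmem⟩ :=
    N.exists_add_smul_mem_feasibleSet hrM hw.1 hv hbal hpath hdemand hle hlarge
  have hd : 0 ≤ N.viOperator c h w (w + ε • d - w) := hw.2 _ hmem
  rw [add_sub_cancel_left, map_smul, smul_eq_mul] at hd
  exact (nonneg_of_mul_nonneg_right hd hε).trans hdv

end ElasticNetwork

theorem theorem4p1_general {V A U : Type*} [Fintype A] (N : ElasticNetwork V A U)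
    (γ : (s : N.odPairs) → N.users s → EReal)
    (c : A → (A → ℝ) → ℝ) (h : (s : N.odPairs) → N.users s → N.Demand → ℝ)
    (hW : (N.feasibleSet γ).Nonempty)
    (hc : ∀ a, ContinuousOn (c a) {f : A → ℝ | ∀ a', 0 ≤ f a'})
    (hh : ∀ s, ∀ j : N.users s,
      ContinuousOn (h s j) {y : N.Demand | ∀ s', ∀ j' : N.users s', 0 ≤ y s' j'})
    (hC : N.Coercive γ c h) :
    ∃ w, N.SolvesVI γ c h w := by
  obtain ⟨r, hr, hcoer⟩ := hC
  have hmin_ne_top (s) (j) : min (γ s j) ((r + 1 : ℝ) : EReal) ≠ ⊤ :=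
    ((min_le_right _ _).trans_lt (EReal.coe_lt_top _)).ne
  have hmin_nonneg (s) (j) : 0 ≤ min (γ s j) ((r + 1 : ℝ) : EReal) := by
    obtain ⟨w, hw⟩ := hW
    obtain ⟨hwj, hwγ⟩ := (hw s).2.2 j
    exact le_min ((EReal.coe_nonneg.2 hwj).trans hwγ) (EReal.coe_nonneg.2 (by positivity))
  obtain ⟨w, hw⟩ := N.exists_solvesVI_of_ne_top hmin_ne_top
    ⟨0, N.zero_mem_feasibleSet hmin_nonneg⟩ hc hh
  have hwγ : w ∈ N.feasibleSet γ := N.feasibleSet_mono (fun _ _ => min_le_left _ _) hw.1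
  exact ⟨w, hw.of_min hr.le (lt_add_one r) fun s j hj => hcoer w hwγ s j hj⟩

/-- Existence of solutions of the generalized network equilibrium problem with elastic demands
without upper bounds. Continuity is only required where flows and demands live, that is, on the
nonnegative orthant. -/
theorem theorem4p1 {V A U : Type*} [Finite V] [Fintype A] (N : ElasticNetwork V A U)
    (γ : (s : N.odPairs) → N.users s → EReal)
    (c : A → (A → ℝ) → ℝ) (h : (s : N.odPairs) → N.users s → N.Demand → ℝ)
    (hγ : ∀ s, ∀ j : N.users s, γ s j = ⊤)
    (hW : (N.feasibleSet γ).Nonempty)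
    (hc : ∀ a, ContinuousOn (c a) {f : A → ℝ | ∀ a', 0 ≤ f a'})
    (hh : ∀ s, ∀ j : N.users s,
      ContinuousOn (h s j) {y : N.Demand | ∀ s', ∀ j' : N.users s', 0 ≤ y s' j'})
    (hC : N.Coercive γ c h) :
    ∃ w, N.SolvesVI γ c h w :=
  theorem4p1_general N γ c h hW hc hh hC
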